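/- Let $\mathcal X$ be a finite simplicial complex of dimension two (no simplex of order greater than $2$) with vertex set $\mathcal V$, edge set $\mathcal E$ and triangle set $\mathcal T$, in which an orientation of every edge and every triangle has been fixed. Let $B_1\in\mathbb R^{\mathcal V\times\mathcal E}$ and $B_2\in\mathbb R^{\mathcal E\times\mathcal T}$ be the incidence matrices: $B_1(v,e)=+1$ if $v$ is the head of $e$, $-1$ if $v$ is the tail of $e$, and $0$ otherwise; $B_2(e,t)=+1$ if $e$ is a side of $t$ with the orientation induced by $t$, $-1$ if $e$ is a side of $t$ with the opposite orientation, and $0$ otherwise. Let $k>0$, let $d_{\mathcal V}\in\mathbb R^{\mathcal V}$ and $d_{\mathcal T}\in\mathbb R^{\mathcal T}$ have non-negative entries, and suppose that $$\Omega_{\mathcal E}=kI-B_1^\top\operatorname{diag}(d_{\mathcal V})B_1-B_2\operatorname{diag}(d_{\mathcal T})B_2^\top$$ is positive definite. Let $x_{\mathcal E}\sim N(0,\Omega_{\mathcal E}^{-1})$ be a Gaussian random vector indexed by $\mathcal E$, and write $x_{\mathcal A}$ for its sub-vector indexed by $\mathcal A\subseteq\mathcal E$. Let $G$ be the graph with node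 set $\mathcal E$ and link set $\mathcal L_d\cup\mathcal L_u$, where for $e\ne e'$ the pair $\{e,e'\}$ is a lower link (is in $\mathcal L_d$) iff $(B_1^\top\operatorname{diag}(d_{\mathcal V})B_1)_{ee'}\neq0$, and an upper link (is in $\mathcal L_u$) iff $(B_2\operatorname{diag}(d_{\mathcal T})B_2^\top)_{ee'}\neq0$; a link may be both. A path in $G$ is monochromatic if all its links are lower links or all its links are upper links. Then: 1. (Global Markov property.) For all pairwise disjoint $\mathcal A,\mathcal B,\mathcal S\subseteq\mathcal E$ such that every path in $G$ from $\mathcal A$ to $\mathcal B$ meets $\mathcal S$, the vectors $x_{\mathcal A}$ and $x_{\mathcal B}$ are conditionally independent given $x_{\mathcal S}$. 2. (Color separation.) For all disjoint $\mathcal A,\mathcal B\subseteq\mathcal E$ such that no monochromatic path in $G$ joins $\mathcal A$ to $\mathcal B$, the vectors $x_{\mathcal A}$ and $x_{\mathcal B}$ are independent. -/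

import Mathlib

open MeasureTheory ProbabilityTheory

namespace ColoredMRF

section Complex

variable {V : Type*}

/-- The simplices of order `k` (i.e. with `k + 1` vertices) of an abstract simplicial complex. -/
def Simplices (X : AbstractSimplicialComplex V) (k : ℕ) : Type _ :=
  {s : Finset V // s ∈ X ∧ s.card = k + 1}

noncomputable instance (X : AbstractSimplicialComplex V) (k : ℕ) : DecidableEq (Simplices X k) :=
  Classical.decEq _

noncomputable instance [Fintype V] (X : AbstractSimplicialComplex V) (k : ℕ) :
    Fintype (Simplices X k) :=
  haveI : Finite (Simplices X k) := inferInstanceAs (Finite {s : Finset V // s ∈ X ∧ s.card = k + 1})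
  Fintype.ofFinite _

/-- The edges: simplices of order one. -/
abbrev Edges (X : AbstractSimplicialComplex V) : Type _ := Simplices X 1

/-- The triangles: simplices of order two. -/
abbrev Triangles (X : AbstractSimplicialComplex V) : Type _ := Simplices X 2

/-- The complex has no simplex of order greater than two. -/
def DimLeTwo (X : AbstractSimplicialComplex V) : Prop := ∀ s ∈ X, s.card ≤ 3

variable [DecidableEq V]

/-- A choice of one of the two orientations of every edge and of every triangle. An orientation of
an edge is an ordering `(tail, head)` of its vertices; an orientation of a triangle is an ordering
of its vertices up to cyclic shift, given here by a representative `(fst, snd, trd)`.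
All vertices are positively oriented. -/
structure Orientation (X : AbstractSimplicialComplex V) where
  tail : Edges X → V
  head : Edges X → V
  edge_eq : ∀ e : Edges X, e.1 = {tail e, head e}
  fst : Triangles X → V
  snd : Triangles X → V
  trd : Triangles X → V
  triangle_eq : ∀ t : Triangles X, t.1 = {fst t, snd t, trd t}

namespace Orientation

variable {X : AbstractSimplicialComplex V} (o : Orientation X)

/-- `(u, v)` is one of the three directed sides `fst → snd`, `snd → trd`, `trd → fst` of the
oriented triangle `t`. -/
def DirectedSide (t : Triangles X) (u v : V) : Prop :=
  (u = o.fst t ∧ v = o.snd t) ∨ (u = o.snd t ∧ v = o.trd t) ∨ (u = o.trd t ∧ v = o.fst t)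

/-- The vertex-edge incidence matrix, of size `|V| × |E|`. -/
def B₁ : Matrix V (Edges X) ℝ := fun v e =>
  if v = o.head e then 1 else if v = o.tail e then -1 else 0

open Classical in
/-- The edge-triangle incidence matrix, of size `|E| × |T|`. -/
noncomputable def B₂ : Matrix (Edges X) (Triangles X) ℝ := fun e t =>
  if o.DirectedSide t (o.tail e) (o.head e) then 1
  else if o.DirectedSide t (o.head e) (o.tail e) then -1
  else 0

variable [Fintype V]

/-- The matrix `B₁ᵀ diag(d_V) B₁` of lower interactions. -/
noncomputable def lowerMatrix (dV : V → ℝ) : Matrix (Edges X) (Edges X) ℝ :=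
  o.B₁.transpose * Matrix.diagonal dV * o.B₁

/-- The matrix `B₂ diag(d_T) B₂ᵀ` of upper interactions. -/
noncomputable def upperMatrix (dT : Triangles X → ℝ) : Matrix (Edges X) (Edges X) ℝ :=
  o.B₂ * Matrix.diagonal dT * o.B₂.transpose

/-- The edge precision matrix `k I - B₁ᵀ diag(d_V) B₁ - B₂ diag(d_T) B₂ᵀ`. -/
noncomputable def edgePrecision (k : ℝ) (dV : V → ℝ) (dT : Triangles X → ℝ) :
    Matrix (Edges X) (Edges X) ℝ :=
  k • (1 : Matrix (Edges X) (Edges X) ℝ) - o.lowerMatrix dV - o.upperMatrix dT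

end Orientation

end Complex

section Graph

/-- A graph whose links carry the color "lower", the color "upper", or both. -/
structure ColoredGraph (N : Type*) where
  lower : SimpleGraph N
  upper : SimpleGraph N

namespace ColoredGraph

variable {N : Type*} (G : ColoredGraph N)

/-- The underlying uncolored graph: its links are the lower links and the upper links. -/
def graph : SimpleGraph N := G.lower ⊔ G.upper

/-- All links of the walk share a color. -/
def IsMonochromatic {a b : N} (p : G.graph.Walk a b) : Prop :=
  (∀ l ∈ p.edges, l ∈ G.lower.edgeSet) ∨ (∀ l ∈ p.edges, l ∈ G.upper.edgeSet)

/-- There is no monochromatic path from `A` to `B`. -/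
def ColorSeparated (A B : Set N) : Prop :=
  ∀ a ∈ A, ∀ b ∈ B, ∀ p : G.graph.Walk a b, p.IsPath → ¬ G.IsMonochromatic p

end ColoredGraph

/-- Every path from `A` to `B` meets `S`. -/
def Separates {N : Type*} (G : SimpleGraph N) (A B S : Set N) : Prop :=
  ∀ a ∈ A, ∀ b ∈ B, ∀ p : G.Walk a b, p.IsPath → ∃ s ∈ p.support, s ∈ S

/-- The graph on the indices of a square matrix `M` with a link `{i, j}`, `i ≠ j`, iff
`M i j ≠ 0` (or `M j i ≠ 0`, which is the same for the symmetric matrices considered here). -/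
def sparsityGraph {N : Type*} (M : Matrix N N ℝ) : SimpleGraph N :=
  SimpleGraph.fromRel fun i j => M i j ≠ 0

/-- The colored Markov random field: lower links are the non-zero off-diagonal entries of
`B₁ᵀ diag(d_V) B₁`, upper links those of `B₂ diag(d_T) B₂ᵀ`. -/
noncomputable def cmrf {V : Type*} [Fintype V] [DecidableEq V] {X : AbstractSimplicialComplex V}
    (o : Orientation X) (dV : V → ℝ) (dT : Triangles X → ℝ) : ColoredGraph (Edges X) where
  lower := sparsityGraph (o.lowerMatrix dV)
  upper := sparsityGraph (o.upperMatrix dT)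

end Graph

section Probability

variable {Ω : Type*} [MeasurableSpace Ω]

/-- The sub-vector `x_A` of a random vector `x`. -/
def restrict {N : Type*} (x : Ω → EuclideanSpace ℝ N) (A : Set N) : Ω → (A → ℝ) :=
  fun ω i => x ω i

/-- Conditional independence of `f` and `g` given (the σ-algebra generated by) `h`, on an arbitrary
probability space. -/
def CondIndepGiven {α β γ : Type*} [MeasurableSpace α] [MeasurableSpace β] [mγ : MeasurableSpace γ]
    (f : Ω → α) (g : Ω → β) (h : Ω → γ) (P : Measure Ω) : Prop :=
  ∀ (s : Set α) (t : Set β), MeasurableSet s → MeasurableSet t →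
    P⟦f ⁻¹' s ∩ g ⁻¹' t | mγ.comap h⟧ =ᵐ[P]
      fun ω => (P⟦f ⁻¹' s | mγ.comap h⟧) ω * (P⟦g ⁻¹' t | mγ.comap h⟧) ω

/-- On standard Borel spaces this is Mathlib's conditional independence. -/
theorem condIndepGiven_iff_condIndepFun {α β γ : Type*} [MeasurableSpace α] [MeasurableSpace β]
    [mγ : MeasurableSpace γ] [StandardBorelSpace Ω] {f : Ω → α} {g : Ω → β} {h : Ω → γ}
    (hf : Measurable f) (hg : Measurable g) (hh : Measurable h) (P : Measure Ω)
    [IsFiniteMeasure P] :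
    CondIndepGiven f g h P ↔ CondIndepFun (mγ.comap h) hh.comap_le f g P :=
  (condIndepFun_iff_condExp_inter_preimage_eq_mul hf hg).symm

/-- The global Markov property of the random vector `x` in the graph `G`. -/
def GlobalMarkov {N : Type*} (G : SimpleGraph N) (x : Ω → EuclideanSpace ℝ N) (P : Measure Ω) :
    Prop :=
  ∀ A B S : Set N, Disjoint A B → Disjoint A S → Disjoint B S → Separates G A B S →
    CondIndepGiven (restrict x A) (restrict x B) (restrict x S) P

end Probability

end ColoredMRF

/-! Write `K = k - L - U` for the precision matrix, with `L` the lower and `U` the upper matrix.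
Markov property: let `R` be the set reachable from `A` off `S`. `K` has no entries from `R` to the
outside of `R ∪ S`, so `(K x)_R = K_RR x_R + K_RS x_S`. As `Cov(K x, x) = 1`, the Gaussian vector
`(K x)_R` is independent of `(x_S, x_B)`; as `K_RR` is invertible, `x_A` is a function of `(K x)_R`
and `x_S`. `condIndepGiven_of_indepFun` concludes. Color separation: `B₁ B₂ = 0` gives `L U = U L =
0`, so `(k - L)(k - U) = k K` and `K⁻¹ = (k - L)⁻¹ + (k - U)⁻¹ - k⁻¹` (`smul_one_sub_sub_inv`). Each
inverse is block diagonal along the components of one color, so the covariance of `x_A` and `x_B`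
vanishes. -/

namespace ColoredMRF

/-! ### Sparsity graphs, matrix inverses and separation. -/

section Graph

variable {N : Type*}

lemma sparsityGraph_adj {M : Matrix N N ℝ} {i j : N} (hij : i ≠ j) (h : M i j ≠ 0) :
    (sparsityGraph M).Adj i j :=
  (SimpleGraph.fromRel_adj _ _ _).2 ⟨hij, Or.inl h⟩

lemma apply_eq_zero_of_reachable_of_not_reachable {M : Matrix N N ℝ} {a i j : N}
    (hi : (sparsityGraph M).Reachable a i) (hj : ¬ (sparsityGraph M).Reachable a j) :
    M i j = 0 ∧ M j i = 0 := by
  have hij : i ≠ j := by rintro rfl; exact hj hi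
  constructor <;> by_contra h
  · exact hj (hi.trans (sparsityGraph_adj hij h).reachable)
  · exact hj (hi.trans (sparsityGraph_adj hij.symm h).symm.reachable)

/-- The inverse of a matrix has no entries between different connected components of the
sparsity graph. -/
lemma inv_apply_eq_zero_of_not_reachable [Fintype N] [DecidableEq N] {M : Matrix N N ℝ} {a b : N}
    (h : ¬ (sparsityGraph M).Reachable a b) : M⁻¹ a b = 0 := by
  classical
  by_cases hM : IsUnit M.det
  swap
  · simp [Matrix.nonsing_inv_apply_not_isUnit M hM]
  -- The projection onto the component of `a` commutes with `M`, hence with `M⁻¹`; the `(a, b)`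
  -- entries of the two products are `M⁻¹ a b` and `0`.
  set D : Matrix N N ℝ :=
    Matrix.diagonal fun i => if (sparsityGraph M).Reachable a i then 1 else 0 with hD
  have hDM : D * M = M * D := by
    ext i j
    rw [hD, Matrix.diagonal_mul, Matrix.mul_diagonal]
    by_cases hi : (sparsityGraph M).Reachable a i <;>
      by_cases hj : (sparsityGraph M).Reachable a j <;> simp only [hi, hj, if_true, if_false]
    · ring
    · simp [apply_eq_zero_of_reachable_of_not_reachable hi hj]
    · simp [apply_eq_zero_of_reachable_of_not_reachable hj hi]
    · ring
  have hinv : D * M⁻¹ = M⁻¹ * D := by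
    calc D * M⁻¹ = M⁻¹ * (M * D) * M⁻¹ := by
          rw [← mul_assoc, Matrix.nonsing_inv_mul M hM, one_mul]
      _ = M⁻¹ * D := by
          rw [← hDM, mul_assoc, mul_assoc, Matrix.mul_nonsing_inv M hM, mul_one]
  have := congrFun (congrFun hinv a) b
  rw [hD, Matrix.diagonal_mul, Matrix.mul_diagonal] at this
  simpa [h] using this

/-- Subtracting from a scalar matrix does not change the sparsity graph. -/
lemma sparsityGraph_smul_one_sub [DecidableEq N] (k : ℝ) (M : Matrix N N ℝ) :
    sparsityGraph (k • (1 : Matrix N N ℝ) - M) = sparsityGraph M := by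
  ext i j
  simp only [sparsityGraph, SimpleGraph.fromRel_adj]
  refine and_congr_right fun hij => ?_
  simp [Matrix.one_apply_ne hij, Matrix.one_apply_ne hij.symm]

/-- If `L U = U L = 0`, the inverse of `k - L - U` is a linear combination of those of `k - L`,
`k - U` and `1`. -/
lemma smul_one_sub_sub_inv [Fintype N] [DecidableEq N] {k : ℝ} (hk : k ≠ 0)
    {L U : Matrix N N ℝ} (hLU : L * U = 0) (hUL : U * L = 0)
    (hdet : IsUnit (k • (1 : Matrix N N ℝ) - L - U).det) :
    (k • (1 : Matrix N N ℝ) - L - U)⁻¹ =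
      (k • (1 : Matrix N N ℝ) - L)⁻¹ + (k • (1 : Matrix N N ℝ) - U)⁻¹ - k⁻¹ • 1 := by
  set K := k • (1 : Matrix N N ℝ) - L - U with hK
  set M := k • (1 : Matrix N N ℝ) - L with hM
  set Q := k • (1 : Matrix N N ℝ) - U with hQ
  have hMQ : M * Q = k • K := by
    simp only [hM, hQ, hK, sub_mul, mul_sub, smul_mul_assoc, mul_smul_comm, one_mul, mul_one, hLU,
      smul_sub]
    abel
  have hQM : Q * M = k • K := by
    simp only [hM, hQ, hK, sub_mul, mul_sub, smul_mul_assoc, mul_smul_comm, one_mul, mul_one, hUL,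
      smul_sub]
    abel
  have hsum : M + Q - k • 1 = K := by simp only [hM, hQ, hK]; abel
  have hkK : IsUnit (k • K).det := by
    rw [Matrix.det_smul]
    exact (IsUnit.mk0 _ (pow_ne_zero _ hk)).mul hdet
  -- Both factors of the invertible matrix `k K` are invertible.
  have hMd : IsUnit M.det := by
    rw [← hMQ, Matrix.det_mul] at hkK; exact isUnit_of_mul_isUnit_left hkK
  have hQd : IsUnit Q.det := by
    rw [← hMQ, Matrix.det_mul] at hkK; exact isUnit_of_mul_isUnit_right hkK
  have hKM : K * M⁻¹ = k⁻¹ • Q := by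
    have : k • K * M⁻¹ = Q := by
      rw [← hQM, mul_assoc, Matrix.mul_nonsing_inv M hMd, mul_one]
    rw [← this, smul_mul_assoc, smul_smul, inv_mul_cancel₀ hk, one_smul]
  have hKQ : K * Q⁻¹ = k⁻¹ • M := by
    have : k • K * Q⁻¹ = M := by
      rw [← hMQ, mul_assoc, Matrix.mul_nonsing_inv Q hQd, mul_one]
    rw [← this, smul_mul_assoc, smul_smul, inv_mul_cancel₀ hk, one_smul]
  refine Matrix.inv_eq_right_inv ?_
  rw [mul_sub, mul_add, hKM, hKQ, mul_smul_comm, mul_one, ← smul_add, ← smul_sub, ← hsum]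
  rw [show Q + M - (M + Q - k • 1) = k • (1 : Matrix N N ℝ) by abel, smul_smul,
    inv_mul_cancel₀ hk, one_smul]

/-- The vertices that can be reached from `A` without meeting `S`. -/
def reachableAvoiding (G : SimpleGraph N) (A S : Set N) : Set N :=
  {v | ∃ a ∈ A, ∃ p : G.Walk a v, ∀ s ∈ p.support, s ∉ S}

lemma subset_reachableAvoiding {G : SimpleGraph N} {A S : Set N} (h : Disjoint A S) :
    A ⊆ reachableAvoiding G A S := fun a ha =>
  ⟨a, ha, .nil, fun s hs => by
    rw [SimpleGraph.Walk.support_nil, List.mem_singleton] at hs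
    exact hs ▸ Set.disjoint_left.1 h ha⟩

lemma disjoint_reachableAvoiding_right (G : SimpleGraph N) (A S : Set N) :
    Disjoint (reachableAvoiding G A S) S :=
  Set.disjoint_left.2 fun v ⟨_, _, p, hp⟩ => hp v p.end_mem_support

lemma Separates.disjoint_reachableAvoiding {G : SimpleGraph N} {A B S : Set N}
    (h : Separates G A B S) : Disjoint (reachableAvoiding G A S) B := by
  classical
  refine Set.disjoint_left.2 fun v ⟨a, ha, p, hp⟩ hv => ?_
  -- Reachability uses walks and separation uses paths; removing loops only shrinks the support.
  obtain ⟨s, hs, hsS⟩ := h a ha v hv p.bypass p.bypass_isPath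
  exact hp s (p.support_bypass_subset_support hs) hsS

lemma mem_reachableAvoiding_of_adj {G : SimpleGraph N} {A S : Set N} {i j : N}
    (hi : i ∈ reachableAvoiding G A S) (hij : G.Adj i j) (hj : j ∉ S) :
    j ∈ reachableAvoiding G A S := by
  obtain ⟨a, ha, p, hp⟩ := hi
  refine ⟨a, ha, p.concat hij, fun s hs => ?_⟩
  rw [SimpleGraph.Walk.support_concat, List.mem_append,
    List.mem_singleton] at hs
  rcases hs with hs | rfl
  exacts [hp s hs, hj]

/-- Color-separated sets are not joined by walks of lower links, nor by walks of upper links. -/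
lemma ColoredGraph.ColorSeparated.not_reachable {G : ColoredGraph N} {A B : Set N}
    (h : G.ColorSeparated A B) {a b : N} (ha : a ∈ A) (hb : b ∈ B) :
    ¬ G.lower.Reachable a b ∧ ¬ G.upper.Reachable a b := by
  classical
  constructor <;> rintro ⟨p⟩
  · have hle : G.lower ≤ G.graph := le_sup_left
    refine h a ha b hb (p.bypass.mapLe hle) (p.bypass_isPath.mapLe _)
      (Or.inl fun l hl => ?_)
    rw [SimpleGraph.Walk.edges_mapLe_eq_edges hle] at hl
    exact p.bypass.edges_subset_edgeSet hl
  · have hle : G.upper ≤ G.graph := le_sup_right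
    refine h a ha b hb (p.bypass.mapLe hle) (p.bypass_isPath.mapLe _)
      (Or.inr fun l hl => ?_)
    rw [SimpleGraph.Walk.edges_mapLe_eq_edges hle] at hl
    exact p.bypass.edges_subset_edgeSet hl

end Graph

/-! ### Incidence matrices and the precision matrix of the complex. -/

section Complex

variable {V : Type*} [DecidableEq V] {X : AbstractSimplicialComplex V}

namespace Orientation

variable (o : Orientation X)

lemma tail_ne_head (e : Edges X) : o.tail e ≠ o.head e := by
  intro h
  have h2 := e.2.2
  rw [o.edge_eq e, h] at h2
  simp at h2

lemma triangle_ne (t : Triangles X) :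
    o.fst t ≠ o.snd t ∧ o.snd t ≠ o.trd t ∧ o.trd t ≠ o.fst t := by
  have h3 := t.2.2
  rw [o.triangle_eq t] at h3
  refine ⟨fun h => ?_, fun h => ?_, fun h => ?_⟩ <;> rw [h] at h3
  · have := Finset.card_le_two (a := o.snd t) (b := o.trd t)
    simp at h3; omega
  · have := Finset.card_le_two (a := o.fst t) (b := o.trd t)
    simp at h3; omega
  · have := Finset.card_le_two (a := o.fst t) (b := o.snd t)
    rw [Finset.pair_comm, Finset.insert_eq_of_mem (Finset.mem_insert_self _ _)] at h3
    omega

/-- The signed indicator of the edge `{u, w}`, with the sign of the direction `u → w`. -/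
def directedIndicator (u w : V) (e : Edges X) : ℝ :=
  if o.tail e = u ∧ o.head e = w then 1 else if o.tail e = w ∧ o.head e = u then -1 else 0

variable [Fintype V]

/-- Only the edge `{u, w}` contributes, and reversing its chosen orientation changes the sign of
both factors. -/
lemma sum_B₁_mul_directedIndicator (v : V) {u w : V} (huw : u ≠ w)
    (hX : ({u, w} : Finset V) ∈ X) :
    ∑ e, o.B₁ v e * o.directedIndicator u w e =
      (if v = w then 1 else 0) - (if v = u then 1 else 0) := by
  let e₀ : Edges X := ⟨{u, w}, hX, Finset.card_pair huw⟩
  rw [Finset.sum_eq_single e₀]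
  · have he : ({u, w} : Finset V) = {o.tail e₀, o.head e₀} := o.edge_eq e₀
    have hne := o.tail_ne_head e₀
    have h1 : o.tail e₀ ∈ ({u, w} : Finset V) := by rw [he]; simp
    have h2 : o.head e₀ ∈ ({u, w} : Finset V) := by rw [he]; simp
    simp only [Finset.mem_insert, Finset.mem_singleton] at h1 h2
    unfold B₁ directedIndicator
    grind
  · intro e _ hne
    have : o.directedIndicator u w e = 0 := by
      unfold directedIndicator
      rw [if_neg, if_neg]
      · rintro ⟨h1, h2⟩
        exact hne (Subtype.ext (by rw [o.edge_eq e, h1, h2, Finset.pair_comm]))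
      · rintro ⟨h1, h2⟩
        exact hne (Subtype.ext (by rw [o.edge_eq e, h1, h2]))
    rw [this, mul_zero]
  · simp

omit [Fintype V] in
-- The three sides of a triangle are distinct edges, so at most one term is nonzero.
lemma B₂_eq_sum_directedIndicator (e : Edges X) (t : Triangles X) :
    o.B₂ e t = o.directedIndicator (o.fst t) (o.snd t) e +
      o.directedIndicator (o.snd t) (o.trd t) e + o.directedIndicator (o.trd t) (o.fst t) e := by
  obtain ⟨h1, h2, h3⟩ := o.triangle_ne t
  have := o.tail_ne_head e
  unfold B₂ directedIndicator DirectedSide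
  grind

/-- The boundary of a boundary vanishes. -/
lemma B₁_mul_B₂ : o.B₁ * o.B₂ = 0 := by
  ext v t
  obtain ⟨h1, h2, h3⟩ := o.triangle_ne t
  have hface : ∀ s : Finset V, s ⊆ t.1 → s.Nonempty → s ∈ X := fun s hs hne =>
    (X.isRelLowerSet_faces t.2.1).2 hs hne
  have ht := o.triangle_eq t
  simp only [Matrix.mul_apply, B₂_eq_sum_directedIndicator, mul_add, Finset.sum_add_distrib,
    Matrix.zero_apply]
  rw [sum_B₁_mul_directedIndicator o v h1 (hface _ (by rw [ht]; grind) (by simp)),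
    sum_B₁_mul_directedIndicator o v h2 (hface _ (by rw [ht]; grind) (by simp)),
    sum_B₁_mul_directedIndicator o v h3 (hface _ (by rw [ht]; grind) (by simp))]
  -- The endpoint differences telescope around the triangle.
  ring

lemma lowerMatrix_mul_upperMatrix (dV : V → ℝ) (dT : Triangles X → ℝ) :
    o.lowerMatrix dV * o.upperMatrix dT = 0 := by
  unfold lowerMatrix upperMatrix
  calc _ = o.B₁.transpose * Matrix.diagonal dV * (o.B₁ * o.B₂) *
        (Matrix.diagonal dT * o.B₂.transpose) := by simp only [Matrix.mul_assoc]
    _ = 0 := by rw [B₁_mul_B₂]; simp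

lemma upperMatrix_mul_lowerMatrix (dV : V → ℝ) (dT : Triangles X → ℝ) :
    o.upperMatrix dT * o.lowerMatrix dV = 0 := by
  unfold lowerMatrix upperMatrix
  calc _ = o.B₂ * Matrix.diagonal dT * (o.B₁ * o.B₂).transpose *
        (Matrix.diagonal dV * o.B₁) := by
          rw [Matrix.transpose_mul]; simp only [Matrix.mul_assoc]
    _ = 0 := by rw [B₁_mul_B₂]; simp

lemma edgePrecision_inv_apply_eq_zero {k : ℝ} (hk : k ≠ 0) {dV : V → ℝ} {dT : Triangles X → ℝ}
    (hdet : IsUnit (o.edgePrecision k dV dT).det) {a b : Edges X} (hab : a ≠ b)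
    (hL : ¬ (cmrf o dV dT).lower.Reachable a b) (hU : ¬ (cmrf o dV dT).upper.Reachable a b) :
    (o.edgePrecision k dV dT)⁻¹ a b = 0 := by
  unfold edgePrecision at hdet ⊢
  rw [smul_one_sub_sub_inv hk (o.lowerMatrix_mul_upperMatrix dV dT)
    (o.upperMatrix_mul_lowerMatrix dV dT) hdet, Matrix.sub_apply, Matrix.add_apply,
    inv_apply_eq_zero_of_not_reachable (by rwa [sparsityGraph_smul_one_sub]),
    inv_apply_eq_zero_of_not_reachable (by rwa [sparsityGraph_smul_one_sub])]
  simp [Matrix.one_apply_ne hab]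

/-- The converse may fail, since lower and upper entries can cancel; the Markov property needs only
this direction. -/
lemma cmrf_graph_adj {k : ℝ} {dV : V → ℝ} {dT : Triangles X → ℝ} {i j : Edges X} (hij : i ≠ j)
    (h : o.edgePrecision k dV dT i j ≠ 0) : (cmrf o dV dT).graph.Adj i j := by
  by_cases hL : o.lowerMatrix dV i j = 0
  · refine Or.inr (sparsityGraph_adj hij fun hU => h ?_)
    simp [edgePrecision, hL, hU, Matrix.one_apply_ne hij]
  · exact Or.inl (sparsityGraph_adj hij hL)

end Orientation

end Complex

/-! ### Conditional independence and Gaussian vectors. -/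

section Probability

variable {Ω : Type*} [mΩ : MeasurableSpace Ω] {P : Measure Ω}

/-- If `W` is independent of `(h, g)`, then every function of `(W, h)` is conditionally independent
of `g` given `h`. -/
lemma condIndepGiven_of_indepFun [IsProbabilityMeasure P] {α β γ δ : Type*} [MeasurableSpace α]
    [MeasurableSpace β] [mγ : MeasurableSpace γ] [MeasurableSpace δ]
    {W : Ω → δ} {g : Ω → β} {h : Ω → γ} {F : δ × γ → α}
    (hW : Measurable W) (hg : Measurable g) (hh : Measurable h) (hF : Measurable F)
    (hind : IndepFun W (fun ω => (h ω, g ω)) P) :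
    CondIndepGiven (fun ω => F (W ω, h ω)) g h P := by
  intro s t hs ht
  set f : Ω → α := fun ω => F (W ω, h ω) with hf_def
  have hf : Measurable f := hF.comp (hW.prodMk hh)
  -- Freezing `h = c` and averaging over `W` gives a version of the conditional probability of `f
  -- ⁻¹' s`.
  set φ : γ → ℝ := fun c => (P.map W).real {w | F (w, c) ∈ s} with hφ
  have : IsProbabilityMeasure (P.map W) := Measure.isProbabilityMeasure_map hW.aemeasurable
  have hφm : Measurable φ :=
    (measurable_measure_prodMk_right (μ := P.map W) (hF hs)).ennreal_toReal
  have hφ1 : ∀ c, ‖φ c‖ ≤ 1 := fun c => by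
    rw [Real.norm_of_nonneg measureReal_nonneg]; exact measureReal_le_one
  have hle : mγ.comap h ≤ mΩ := hh.comap_le
  have hφhm : StronglyMeasurable[mγ.comap h] (fun ω => φ (h ω)) :=
    (hφm.comp (comap_measurable h)).stronglyMeasurable
  have key : ∀ (u : Set γ) (t : Set β), MeasurableSet u → MeasurableSet t →
      ∫ ω in h ⁻¹' u, φ (h ω) * (g ⁻¹' t).indicator (fun _ => (1 : ℝ)) ω ∂P =
        ∫ ω in h ⁻¹' u, (f ⁻¹' s ∩ g ⁻¹' t).indicator (fun _ => (1 : ℝ)) ω ∂P := by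
    intro u t hu ht
    have hut : MeasurableSet (u ×ˢ t) := hu.prod ht
    have hgh : Measurable fun ω => (h ω, g ω) := hh.prodMk hg
    have hset : MeasurableSet {q : δ × γ × β | F (q.1, q.2.1) ∈ s ∧ q.2 ∈ u ×ˢ t} :=
      ((hF.comp (measurable_fst.prodMk (measurable_fst.comp measurable_snd))) hs).inter
        (measurable_snd hut)
    have hmap := (indepFun_iff_map_prod_eq_prod_map_map hW.aemeasurable hgh.aemeasurable).1 hind
    have hpair : Measurable fun ω => (W ω, (h ω, g ω)) := hW.prodMk hgh
    have hR : ∫ ω in h ⁻¹' u, (f ⁻¹' s ∩ g ⁻¹' t).indicator (fun _ => (1 : ℝ)) ω ∂P =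
        ∫ q, {q : δ × γ × β | F (q.1, q.2.1) ∈ s ∧ q.2 ∈ u ×ˢ t}.indicator
          (fun _ => (1 : ℝ)) q ∂((P.map W).prod (P.map fun ω => (h ω, g ω))) := by
      rw [← hmap, integral_map hpair.aemeasurable
        (measurable_const.indicator hset).aestronglyMeasurable, ← integral_indicator (hh hu)]
      refine integral_congr_ae (Filter.Eventually.of_forall fun ω => ?_)
      by_cases h1 : h ω ∈ u <;> by_cases h2 : g ω ∈ t <;> by_cases h3 : F (W ω, h ω) ∈ s <;>
        simp [hf_def, h1, h2, h3]
    have : IsProbabilityMeasure (P.map fun ω => (h ω, g ω)) :=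
      Measure.isProbabilityMeasure_map hgh.aemeasurable
    -- Fubini, with `W` integrated first: the inner integral is `φ` times the indicators of `u` and
    -- `t`.
    rw [hR, integral_prod_symm _ ((integrable_const (1 : ℝ)).indicator hset),
      integral_map hgh.aemeasurable, ← integral_indicator (hh hu)]
    · refine integral_congr_ae (Filter.Eventually.of_forall fun ω => ?_)
      have hsl : MeasurableSet {w | F (w, h ω) ∈ s} :=
        (hF.comp (measurable_id.prodMk measurable_const)) hs
      by_cases h1 : h ω ∈ u <;> by_cases h2 : g ω ∈ t <;>
        simp [h1, h2]
      refine (integral_indicator_one (μ := P.map W) hsl).symm.trans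
        (integral_congr_ae (Filter.Eventually.of_forall fun w => ?_))
      by_cases h3 : F (w, h ω) ∈ s <;> simp [h1, h2, h3]
    · exact ((measurable_const.indicator hset).stronglyMeasurable.integral_prod_left'
        ).aestronglyMeasurable
  have hcond : ∀ t : Set β, MeasurableSet t →
      P⟦f ⁻¹' s ∩ g ⁻¹' t | mγ.comap h⟧ =ᵐ[P]
        fun ω => φ (h ω) * (P⟦g ⁻¹' t | mγ.comap h⟧) ω := by
    intro t ht
    have hint : Integrable ((g ⁻¹' t).indicator fun _ => (1 : ℝ)) P :=
      (integrable_const _).indicator (hg ht)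
    -- The bounded factor `φ ∘ h` is measurable for the conditioning σ-algebra, so it comes out of
    -- the conditional expectation.
    have hpull := condExp_stronglyMeasurable_mul_of_bound hle hφhm hint 1
      (Filter.Eventually.of_forall fun ω => hφ1 _)
    refine Filter.EventuallyEq.trans ?_ hpull
    refine (ae_eq_condExp_of_forall_setIntegral_eq hle ?_
      (fun _ _ _ => integrable_condExp.integrableOn) ?_
      stronglyMeasurable_condExp.aestronglyMeasurable)
    · exact hint.bdd_mul (hφhm.mono hle).aestronglyMeasurable
        (Filter.Eventually.of_forall fun ω => hφ1 _)
    · rintro _ ⟨u, hu, rfl⟩ _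
      rw [setIntegral_condExp hle ((integrable_const _).indicator ((hf hs).inter (hg ht)))
        ⟨u, hu, rfl⟩]
      exact (key u t hu ht).symm
  -- Taking `t = univ` identifies `φ ∘ h` with the conditional probability of `f ⁻¹' s`.
  have h1 := hcond Set.univ MeasurableSet.univ
  filter_upwards [hcond t ht, h1] with ω h2 h3
  rw [h2]
  simp only [Set.preimage_univ, Set.inter_univ, Set.indicator_univ,
    condExp_const hle (1 : ℝ), mul_one] at h3
  rw [h3]

lemma measurable_restrict {N : Type*} {x : Ω → EuclideanSpace ℝ N} (hx : Measurable x)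
    (A : Set N) : Measurable (restrict x A) :=
  measurable_pi_lambda _ fun i => by unfold restrict; fun_prop

variable {N : Type*} [Fintype N]

/-- Uncorrelated finite families of linear functionals of a Gaussian vector are independent. -/
lemma indepFun_linear_of_covariance_eq_zero {ι κ : Type*} [Finite ι] [Finite κ]
    {x : Ω → EuclideanSpace ℝ N} (hx : HasGaussianLaw x P)
    (L : ι → EuclideanSpace ℝ N →L[ℝ] ℝ) (M : κ → EuclideanSpace ℝ N →L[ℝ] ℝ)
    (h : ∀ i j, cov[fun ω => L i (x ω), fun ω => M j (x ω); P] = 0) :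
    IndepFun (fun ω i => L i (x ω)) (fun ω j => M j (x ω)) P := by
  have := Fintype.ofFinite ι
  have := Fintype.ofFinite κ
  exact HasGaussianLaw.indepFun_of_covariance_eval (X := fun i ω => L i (x ω))
    (Y := fun j ω => M j (x ω))
    (hx.map_fun ((ContinuousLinearMap.pi L).prod (ContinuousLinearMap.pi M))) h

variable [DecidableEq N] {C : Matrix N N ℝ} {x : Ω → EuclideanSpace ℝ N}

lemma covariance_apply_of_hasLaw (hC : C.PosSemidef) (hlaw : HasLaw x (multivariateGaussian 0 C) P)
    (i j : N) : cov[fun ω => x ω i, fun ω => x ω j; P] = C i j := by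
  rw [hlaw.covariance_fun_comp (f := fun y => y i) (g := fun y => y j)
    (Measurable.aemeasurable (by fun_prop)) (Measurable.aemeasurable (by fun_prop)),
    covariance_eval_multivariateGaussian hC]

/-- Sub-vectors of a Gaussian vector with vanishing cross-covariance are independent. -/
lemma indepFun_restrict_of_forall_eq_zero (hC : C.PosSemidef)
    (hlaw : HasLaw x (multivariateGaussian 0 C) P) {A B : Set N}
    (h : ∀ a ∈ A, ∀ b ∈ B, C a b = 0) : IndepFun (restrict x A) (restrict x B) P :=
  indepFun_linear_of_covariance_eq_zero hlaw.hasGaussianLaw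
    (fun i : A => EuclideanSpace.proj i.1) (fun j : B => EuclideanSpace.proj j.1)
    fun i j => (covariance_apply_of_hasLaw hC hlaw i j).trans (h i i.2 j j.2)

/-- For a Gaussian vector with precision matrix `K`, the `i`-th entry of `K x` is uncorrelated with
every `x j`, `j ≠ i`. -/
lemma covariance_sum_mul_apply {K : Matrix N N ℝ} (hK : K.PosDef)
    (hlaw : HasLaw x (multivariateGaussian 0 K⁻¹) P) (i j : N) :
    cov[fun ω => ∑ l, K i l * x ω l, fun ω => x ω j; P] = (1 : Matrix N N ℝ) i j := by
  have hmem : ∀ l, MemLp (fun ω => x ω l) 2 P := fun l =>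
    (hlaw.hasGaussianLaw.map_fun (EuclideanSpace.proj l : EuclideanSpace ℝ N →L[ℝ] ℝ)).memLp_two
  have := hlaw.isProbabilityMeasure
  rw [covariance_fun_sum_left (fun l => (hmem l).const_mul _) (hmem j)]
  simp_rw [covariance_const_mul_left, covariance_apply_of_hasLaw hK.inv.posSemidef hlaw]
  rw [← Matrix.mul_apply, Matrix.mul_nonsing_inv K ((Matrix.isUnit_iff_isUnit_det K).1 hK.isUnit)]

omit [DecidableEq N] in
lemma sum_indicator_eq_sum_coe (s : Set N) [Fintype s] (f : N → ℝ) :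
    ∑ l, s.indicator f l = ∑ l : s, f l := by
  classical
  rw [Finset.sum_set_coe s (f := f), ← Finset.sum_indicator_subset f s.toFinset.subset_univ,
    Set.coe_toFinset]

/-- The global Markov property of a Gaussian vector whose precision matrix is supported on the
links of `G`. -/
theorem globalMarkov_of_hasLaw_multivariateGaussian {K : Matrix N N ℝ} (hK : K.PosDef)
    (hx : Measurable x) (hlaw : HasLaw x (multivariateGaussian 0 K⁻¹) P) {G : SimpleGraph N}
    (hG : ∀ i j, i ≠ j → K i j ≠ 0 → G.Adj i j) : GlobalMarkov G x P := by
  classical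
  have := hlaw.isProbabilityMeasure
  intro A B S _ hAS hBS hsep
  set R := reachableAvoiding G A S
  have hAR : A ⊆ R := subset_reachableAvoiding hAS
  have hRS : Disjoint R S := disjoint_reachableAvoiding_right G A S
  have hRB : Disjoint R B := hsep.disjoint_reachableAvoiding
  have hzero : ∀ i ∈ R, ∀ j, j ∉ R → j ∉ S → K i j = 0 := by
    intro i hi j hj hjS
    by_contra h
    exact hj (mem_reachableAvoiding_of_adj hi (hG i j (fun e => hj (e ▸ hi)) h) hjS)
  set W : Ω → R → ℝ := fun ω i => ∑ l, K i l * x ω l with hW_def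
  set KR : Matrix R R ℝ := K.submatrix Subtype.val Subtype.val with hKR
  -- A principal submatrix of a positive definite matrix is positive definite.
  have hKRdet : IsUnit KR.det :=
    (Matrix.isUnit_iff_isUnit_det KR).1 (hK.submatrix Subtype.val_injective).isUnit
  set KS : Matrix R S ℝ := K.submatrix Subtype.val Subtype.val with hKS
  have hWeq : ∀ ω, W ω = KR.mulVec (restrict x R ω) + KS.mulVec (restrict x S ω) := by
    intro ω
    ext i
    have hsplit : ∀ l, K i l * x ω l =
        R.indicator (fun l => K i l * x ω l) l + S.indicator (fun l => K i l * x ω l) l := by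
      intro l
      by_cases hl : l ∈ R
      · simp [hl, Set.disjoint_left.1 hRS hl]
      · by_cases hl' : l ∈ S
        · simp [hl, hl']
        · simp [hl, hl', hzero i i.2 l hl hl']
    simp only [hW_def, Pi.add_apply, Matrix.mulVec, dotProduct]
    rw [Finset.sum_congr rfl fun l _ => hsplit l, Finset.sum_add_distrib]
    congr 1
    · exact sum_indicator_eq_sum_coe R fun l => K i l * x ω l
    · exact sum_indicator_eq_sum_coe S fun l => K i l * x ω l
  have hsolve : ∀ ω, restrict x R ω = KR⁻¹.mulVec (W ω - KS.mulVec (restrict x S ω)) := by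
    intro ω
    rw [hWeq, add_sub_cancel_right, Matrix.mulVec_mulVec, Matrix.nonsing_inv_mul KR hKRdet,
      Matrix.one_mulVec]
  let F : (R → ℝ) × (S → ℝ) → (A → ℝ) := fun q i =>
    KR⁻¹.mulVec (q.1 - KS.mulVec q.2) ⟨i, hAR i.2⟩
  have hF : Measurable F := by
    refine Continuous.measurable ?_
    fun_prop
  have hxA : restrict x A = fun ω => F (W ω, restrict x S ω) := by
    ext ω i
    exact congrFun (hsolve ω) ⟨i, hAR i.2⟩
  have hWm : Measurable W := measurable_pi_lambda _ fun i => by simp only [hW_def]; fun_prop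
  -- `S ∪ B` misses `R`, so the covariances are off-diagonal entries of the identity.
  have hind : IndepFun W (fun ω => fun j : ↥(S ∪ B) => x ω j) P := by
    have := indepFun_linear_of_covariance_eq_zero hlaw.hasGaussianLaw
      (fun i : R => ∑ l, K i l • (EuclideanSpace.proj l : EuclideanSpace ℝ N →L[ℝ] ℝ))
      (fun j : ↥(S ∪ B) => EuclideanSpace.proj j.1) ?_
    · simpa [hW_def] using this
    · intro i j
      have hij : i.1 ≠ j.1 := fun e => by
        rcases j.2 with h | h
        · exact Set.disjoint_left.1 hRS i.2 (e ▸ h)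
        · exact Set.disjoint_left.1 hRB i.2 (e ▸ h)
      simpa [Matrix.one_apply_ne hij] using covariance_sum_mul_apply hK hlaw i.1 j.1
  rw [hxA]
  refine condIndepGiven_of_indepFun hWm (measurable_restrict hx B) (measurable_restrict hx S) hF ?_
  exact hind.comp (φ := id)
    (ψ := fun y => (fun s : S => y ⟨s, Or.inl s.2⟩, fun b : B => y ⟨b, Or.inr b.2⟩))
    measurable_id (by fun_prop)

end Probability

end ColoredMRF

theorem mainTheorem1 {V : Type*} [Fintype V] [DecidableEq V]
    (X : AbstractSimplicialComplex V) (hX : ColoredMRF.DimLeTwo X)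
    (o : ColoredMRF.Orientation X)
    (k : ℝ) (hk : 0 < k)
    (dV : V → ℝ) (hdV : ∀ v, 0 ≤ dV v)
    (dT : ColoredMRF.Triangles X → ℝ) (hdT : ∀ t, 0 ≤ dT t)
    (hprec : (o.edgePrecision k dV dT).PosDef)
    {Ω : Type*} [MeasurableSpace Ω] (P : Measure Ω) [IsProbabilityMeasure P]
    (x : Ω → EuclideanSpace ℝ (ColoredMRF.Edges X)) (hx : Measurable x)
    (hlaw : HasLaw x (multivariateGaussian 0 (o.edgePrecision k dV dT)⁻¹) P) :
    ColoredMRF.GlobalMarkov (ColoredMRF.cmrf o dV dT).graph x P ∧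
    (∀ A B : Set (ColoredMRF.Edges X), Disjoint A B →
      (ColoredMRF.cmrf o dV dT).ColorSeparated A B →
      IndepFun (ColoredMRF.restrict x A) (ColoredMRF.restrict x B) P) := by
  refine ⟨ColoredMRF.globalMarkov_of_hasLaw_multivariateGaussian hprec hx hlaw
    fun _ _ => o.cmrf_graph_adj, fun A B hAB hsep => ?_⟩
  refine ColoredMRF.indepFun_restrict_of_forall_eq_zero hprec.inv.posSemidef hlaw
    fun a ha b hb => ?_
  obtain ⟨hL, hU⟩ := hsep.not_reachable ha hb
  exact o.edgePrecision_inv_apply_eq_zero hk.ne'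
    ((Matrix.isUnit_iff_isUnit_det _).1 hprec.isUnit) (hAB.ne_of_mem ha hb) hL hU
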